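/- Let $A$ be a totally ordered integral domain (commutative, with $1$), and let $S$ be a Specker $A$-algebra, i.e. a commutative unital $A$-algebra that is generated as an $A$-algebra by a Boolean subalgebra $B$ of the Boolean algebra $\mathrm{Id}(S)$ of idempotents of $S$ (with $e\wedge k=ek$, $e\vee k=e+k-ek$, $\neg e=1-e$) such that each nonzero $e\in B$ is faithful: $ae=0$ with $a\in A$ implies $a=0$. A partial order $\le$ on $S$ makes $S$ a torsion-free $f$-algebra over $A$ if it is a lattice order; $s\le t$ implies $s+r\le t+r$; $0\le s,t$ implies $0\le st$; $0\le a\in A$ and $0\le s\in S$ imply $0\le as$; $s\wedge t=0$ and $r\ge 0$ imply $sr\wedge t=0$; and $as=0$ with $a\in A$, $s\in S$ implies $a=0$ or $s=0$. A proximity on a Boolean algebra is a binary relation $\prec$ on it such that: $1\prec1$; $a\prec b$ implies $a\le b$; $a\le b\prec c\le d$ implies $a\prec d$; $a\prec b$ and $a\prec c$ imply $a\prec b\wedge c$; $a\prec b$ implies $\neg b\prec\neg a$; $a\prec b$ implies $a\prec c\prec b$ for some $c$; and for each $a\neq0$ there is $b\ne0$ with $b\prec a$. A proximity on a torsion-free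 $f$-algebra $S$ over $A$ is a binary relation $\prec$ on $S$ such that for all $s,t,r,u\in S$: (P1) $0\prec0$ and $1\prec1$; (P2) $s\prec t$ implies $s\le t$; (P3) $s\le t\prec r\le u$ implies $s\prec u$; (P4) $s\prec t$ and $s\prec r$ imply $s\prec t\wedge r$; (P5) $s\prec t$ implies $-t\prec-s$; (P6) $s\prec t$ and $r\prec u$ imply $s+r\prec t+u$; (P7) $s\prec t$ implies $as\prec at$ for each $0<a\in A$, and $as\prec at$ for some $0<a\in A$ implies $s\prec t$; (P8) if $s,t,r,u\ge0$, then $s\prec t$ and $r\prec u$ imply $sr\prec tu$; (P9) $s\prec t$ implies $s\prec v\prec t$ for some $v\in S$; (P10) if $s>0$, there is $v\in S$ with $0<v\prec s$. Then there is exactly one partial order on $S$ making it a torsion-free $f$-algebra over $A$, and with respect to this order: 1. each proximity on $\mathrm{Id}(S)$ extends to a unique proximity on $S$, that is, it is the restriction to $\mathrm{Id}(S)$ of exactly one proximity on $S$; 2. any two proximities on $S$ that restrict to the same relation on $\mathrm{Id}(S)$ are equal; 3. restriction of relations from $S$ to $\mathrm{Id}(S)$ is a bijection from the set of proximities on $S$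 onto the set of proximities on $\mathrm{Id}(S)$. -/

import Mathlib

/-- The set `Id(S)` of idempotents of a commutative ring `S`. It is a type of its own (not a
reducible subtype), so that its only order is the Boolean order below. -/
def Idem (S : Type*) [CommRing S] : Type _ := {e : S // IsIdempotentElem e}

/-- The underlying element of an idempotent. -/
def Idem.val {S : Type*} [CommRing S] (e : Idem S) : S := Subtype.val e

/-- The Boolean algebra of idempotents: `e ∧ k = ek`, `e ∨ k = e + k - ek`, `¬e = 1 - e`. -/
instance Idem.instBooleanAlgebra (S : Type*) [CommRing S] : BooleanAlgebra (Idem S) :=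
  inferInstanceAs (BooleanAlgebra {e : S // IsIdempotentElem e})

theorem Idem.ext {S : Type*} [CommRing S] {e k : Idem S} (h : e.val = k.val) : e = k :=
  Subtype.ext h

theorem Idem.isIdempotentElem_val {S : Type*} [CommRing S] (e : Idem S) :
    IsIdempotentElem e.val := Subtype.property e

theorem Idem.val_inf {S : Type*} [CommRing S] (e k : Idem S) :
    (e ⊓ k).val = e.val * k.val := rfl

theorem Idem.val_sup {S : Type*} [CommRing S] (e k : Idem S) :
    (e ⊔ k).val = e.val + k.val - e.val * k.val := rfl

theorem Idem.val_compl {S : Type*} [CommRing S] (e : Idem S) : (eᶜ).val = 1 - e.val := rfl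

theorem Idem.val_top {S : Type*} [CommRing S] : (⊤ : Idem S).val = 1 := rfl

theorem Idem.val_bot {S : Type*} [CommRing S] : (⊥ : Idem S).val = 0 := rfl

theorem Idem.le_iff {S : Type*} [CommRing S] (e k : Idem S) :
    e ≤ k ↔ e.val * k.val = e.val := by
  rw [← inf_eq_left, ← Idem.val_inf]
  exact ⟨fun h => congrArg Idem.val h, Idem.ext⟩

/-- `S` is a Specker `A`-algebra: it is generated as an `A`-algebra by a Boolean subalgebra `B`
of `Id(S)` all of whose nonzero elements `e` are faithful (`a e = 0` implies `a = 0`). -/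
def IsSpeckerAlgebra (A S : Type*) [CommRing A] [CommRing S] [Algebra A S] : Prop :=
  ∃ B : BooleanSubalgebra (Idem S),
    (∀ e ∈ B, e ≠ ⊥ → ∀ a : A, a • e.val = 0 → a = 0) ∧
    Algebra.adjoin A (Idem.val '' (B : Set (Idem S))) = ⊤

/-- With the given lattice order, the commutative `A`-algebra `S` is a torsion-free `f`-algebra
over the ordered ring `A`. The first two fields say that `S` is a lattice-ordered ring, the fourth
that this ring is an `f`-ring. -/
structure IsTorsionFreeFAlgebra (A S : Type*) [CommRing A] [LinearOrder A]
    [CommRing S] [Algebra A S] [Lattice S] : Prop where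
  add_le_add_right : ∀ s t r : S, s ≤ t → s + r ≤ t + r
  mul_nonneg : ∀ s t : S, 0 ≤ s → 0 ≤ t → 0 ≤ s * t
  smul_nonneg : ∀ (a : A) (s : S), 0 ≤ a → 0 ≤ s → 0 ≤ a • s
  mul_inf_eq_zero : ∀ s t r : S, s ⊓ t = 0 → 0 ≤ r → (s * r) ⊓ t = 0
  torsion_free : ∀ (a : A) (s : S), a • s = 0 → a = 0 ∨ s = 0

/-- Proximities (de Vries) on a Boolean algebra. -/
structure IsBooleanProximity {B : Type*} [BooleanAlgebra B] (R : B → B → Prop) : Prop where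
  dv1 : R ⊤ ⊤
  dv2 : ∀ a b, R a b → a ≤ b
  dv3 : ∀ a b c d, a ≤ b → R b c → c ≤ d → R a d
  dv4 : ∀ a b c, R a b → R a c → R a (b ⊓ c)
  dv5 : ∀ a b, R a b → R bᶜ aᶜ
  dv6 : ∀ a b, R a b → ∃ c, R a c ∧ R c b
  dv7 : ∀ a, a ≠ ⊥ → ∃ b, b ≠ ⊥ ∧ R b a

/-- Proximities on an `A`-algebra `S` with a lattice order; meant for torsion-free
`f`-algebras `S` over `A`. -/
structure IsAlgebraProximity (A : Type*) {S : Type*} [CommRing A] [LinearOrder A]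
    [CommRing S] [Algebra A S] [Lattice S] (P : S → S → Prop) : Prop where
  p1_zero : P 0 0
  p1_one : P 1 1
  p2 : ∀ s t, P s t → s ≤ t
  p3 : ∀ s t r u, s ≤ t → P t r → r ≤ u → P s u
  p4 : ∀ s t r, P s t → P s r → P s (t ⊓ r)
  p5 : ∀ s t, P s t → P (-t) (-s)
  p6 : ∀ s t r u, P s t → P r u → P (s + r) (t + u)
  p7 : ∀ s t, P s t → ∀ a : A, 0 < a → P (a • s) (a • t)
  p7_cancel : ∀ (s t : S) (a : A), 0 < a → P (a • s) (a • t) → P s t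
  p8 : ∀ s t r u, 0 ≤ s → 0 ≤ t → 0 ≤ r → 0 ≤ u → P s t → P r u → P (s * r) (t * u)
  p9 : ∀ s t, P s t → ∃ r, P s r ∧ P r t
  p10 : ∀ s, 0 < s → ∃ t, 0 < t ∧ P t s

/-- The restriction to `Id(S)` of a binary relation on `S`. -/
def restrictToIdem {S : Type*} [CommRing S] (P : S → S → Prop) : Idem S → Idem S → Prop :=
  fun e k => P e.val k.val

/-! `S` is an algebra of finitely valued functions on the set of homomorphisms `φ : S →ₐ[A] A`. Each
element is a combination over a finite orthogonal partition from `B`, and each faithful idempotent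
takes the value `1` at some `φ`; hence the `φ` separate points (`ext_algHom`), and binary operations
on `A` act pointwise (`exists_map₂`). Squares are nonnegative in an `f`-ring, so idempotents are,
and torsion-freeness then forces the order to be pointwise (`le_iff`).

With `[s ≥ a]` the idempotent of the set where `s` is at least `a`, every proximity on `S` satisfies
`s ≺ t` iff `[s ≥ a] ≺ [t ≥ a]` for all `a` (`eq_extend`). Clipping `s` between neighbouring values
isolates a multiple of `[s ≥ a]`; conversely `s` is a constant plus a positive combination of such
idempotents. The same formula extends any Boolean proximity (`isAlgebraProximity_extend`). -/

/-! ### Representation by `A`-valued functions. -/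

namespace IsSpeckerAlgebra

variable {A S : Type*} [CommRing A] [CommRing S] [Algebra A S]

/-- Every element of a Specker algebra is a linear combination of the members of a finite
orthogonal partition of unity by faithful idempotents. -/
theorem exists_decomposition {B : BooleanSubalgebra (Idem S)}
    (hB : Algebra.adjoin A (Idem.val '' (B : Set (Idem S))) = ⊤) (s : S) :
    ∃ (ι : Type) (_ : Fintype ι) (e : ι → Idem S) (a : ι → A),
      (∀ i, e i ∈ B) ∧ (∀ i j, i ≠ j → (e i).val * (e j).val = 0) ∧
      ∑ i, (e i).val = 1 ∧ s = ∑ i, a i • (e i).val := by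
  classical
  have sum_mul_sum' : ∀ {ι κ : Type} [Fintype ι] [Fintype κ] (f : ι → S) (g : κ → S), (∑ i, f i) * (∑ j, g j) = ∑ p : ι × κ, f p.1 * g p.2 := by
    intro ι κ _ _ f g
    rw [Finset.sum_mul_sum, Fintype.sum_prod_type]
  have hs : s ∈ Algebra.adjoin A (Idem.val '' (B : Set (Idem S))) := by rw [hB]; trivial
  induction hs using Algebra.adjoin_induction with
  | mem x hx =>
    obtain ⟨e, he, rfl⟩ := hx
    refine ⟨Bool, inferInstance, fun b => cond b e eᶜ, fun b => cond b 1 0, ?_, ?_, ?_, ?_⟩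
    · rintro (_ | _)
      · exact B.compl_mem he
      · exact he
    · have := e.isIdempotentElem_val.eq
      rintro (_ | _) (_ | _) h <;> simp_all [Idem.val_compl, mul_sub, sub_mul]
    · simp [Idem.val_compl]
    · simp
  | algebraMap r =>
    refine ⟨Unit, inferInstance, fun _ => ⊤, fun _ => r, fun _ => B.top_mem, ?_, ?_, ?_⟩
    · intro i j h; exact (h rfl).elim
    · simp [Idem.val_top]
    · simp [Idem.val_top, Algebra.algebraMap_eq_smul_one]
  | add x y hx hy ihx ihy =>
    obtain ⟨ι, _, e, a, heB, heo, he1, rfl⟩ := ihx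
    obtain ⟨κ, _, k, b, hkB, hko, hk1, rfl⟩ := ihy
    -- The products `e i * k j` refine both partitions; some may be `0`, which is harmless.
    refine ⟨ι × κ, inferInstance, fun p => e p.1 ⊓ k p.2, fun p => a p.1 + b p.2,
      fun p => B.inf_mem (heB _) (hkB _), ?_, ?_, ?_⟩
    · rintro ⟨i, j⟩ ⟨i', j'⟩ h
      simp only [Idem.val_inf]
      by_cases hi : i = i'
      · have hj : j ≠ j' := fun hj => h (by rw [hi, hj])
        rw [mul_mul_mul_comm, hko _ _ hj, mul_zero]
      · rw [mul_mul_mul_comm, heo _ _ hi, zero_mul]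
    · simp only [Idem.val_inf]
      rw [← sum_mul_sum' (fun i => (e i).val) fun j => (k j).val, he1, hk1, mul_one]
    · calc _ = (∑ i, a i • (e i).val) * (∑ j, (k j).val)
            + (∑ i, (e i).val) * (∑ j, b j • (k j).val) := by rw [he1, hk1, mul_one, one_mul]
        _ = _ := by
          rw [sum_mul_sum', sum_mul_sum', ← Finset.sum_add_distrib]
          refine Finset.sum_congr rfl fun p _ => ?_
          rw [Idem.val_inf, add_smul, smul_mul_assoc, mul_smul_comm]
  | mul x y hx hy ihx ihy =>
    obtain ⟨ι, _, e, a, heB, heo, he1, rfl⟩ := ihx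
    obtain ⟨κ, _, k, b, hkB, hko, hk1, rfl⟩ := ihy
    refine ⟨ι × κ, inferInstance, fun p => e p.1 ⊓ k p.2, fun p => a p.1 * b p.2,
      fun p => B.inf_mem (heB _) (hkB _), ?_, ?_, ?_⟩
    · rintro ⟨i, j⟩ ⟨i', j'⟩ h
      simp only [Idem.val_inf]
      by_cases hi : i = i'
      · have hj : j ≠ j' := fun hj => h (by rw [hi, hj])
        rw [mul_mul_mul_comm, hko _ _ hj, mul_zero]
      · rw [mul_mul_mul_comm, heo _ _ hi, zero_mul]
    · simp only [Idem.val_inf]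
      rw [← sum_mul_sum' (fun i => (e i).val) fun j => (k j).val, he1, hk1, mul_one]
    · rw [sum_mul_sum']
      refine Finset.sum_congr rfl fun p _ => ?_
      rw [Idem.val_inf, smul_mul_smul_comm]

theorem map_idem_eq_zero_or_one [IsDomain A] (φ : S →ₐ[A] A) (e : Idem S) :
    φ e.val = 0 ∨ φ e.val = 1 := by
  have h : IsIdempotentElem (φ e.val) := e.isIdempotentElem_val.map φ
  exact IsIdempotentElem.iff_eq_zero_or_one.1 h

/-- A nonzero faithful idempotent is sent to `1` by some `A`-algebra homomorphism to `A`. -/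
theorem exists_algHom_eq_one [IsDomain A] {B : BooleanSubalgebra (Idem S)}
    (hB : Algebra.adjoin A (Idem.val '' (B : Set (Idem S))) = ⊤) (e : Idem S)
    (he : ∀ a : A, a • e.val = 0 → a = 0) : ∃ φ : S →ₐ[A] A, φ e.val = 1 := by
  -- These elements act on `e` as nonzero scalars; faithfulness keeps `0` out. A prime ideal
  -- avoiding `M` contains neither `e` nor any nonzero constant.
  let M : Submonoid S :=
    { carrier := {x | ∃ a : A, a ≠ 0 ∧ e.val * x = a • e.val}
      one_mem' := ⟨1, one_ne_zero, by simp⟩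
      mul_mem' := by
        rintro x y ⟨a, ha, hx⟩ ⟨b, hb, hy⟩
        refine ⟨a * b, mul_ne_zero ha hb, ?_⟩
        rw [← mul_assoc, hx, smul_mul_assoc, hy, smul_smul] }
  have hdisj : Disjoint ((⊥ : Ideal S) : Set S) (M : Set S) := by
    rw [Set.disjoint_left]
    rintro x hx ⟨a, ha, h⟩
    have hx : x = 0 := by simpa using hx
    exact ha (he a (by rw [← h, hx, mul_zero]))
  obtain ⟨p, hp, -, hpM⟩ := Ideal.exists_le_prime_disjoint (⊥ : Ideal S) M hdisj
  rw [Set.disjoint_left] at hpM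
  have hep : e.val ∉ p := fun h =>
    hpM h ⟨1, one_ne_zero, by rw [one_smul]; exact e.isIdempotentElem_val.eq⟩
  have hinj : Function.Injective (Algebra.ofId A (S ⧸ p)) := by
    rw [injective_iff_map_eq_zero]
    intro a ha
    by_contra hne
    have hmem : algebraMap A S a ∈ p := Ideal.Quotient.eq_zero_iff_mem.1 ha
    exact hpM hmem ⟨a, hne, by rw [Algebra.smul_def, mul_comm]⟩
  -- `S` is generated by idempotents, and in the domain `S ⧸ p` these become `0` or `1`; so `S ⧸ p`
  -- is a copy of `A`.
  have hsurj : Function.Surjective (Algebra.ofId A (S ⧸ p)) := by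
    rw [← AlgHom.range_eq_top, eq_top_iff, ← (AlgHom.range_eq_top (Ideal.Quotient.mkₐ A p)).2
      (Ideal.Quotient.mkₐ_surjective A p), ← Algebra.map_top, ← hB, AlgHom.map_adjoin,
      Algebra.adjoin_le_iff]
    rintro _ ⟨_, ⟨k, -, rfl⟩, rfl⟩
    have hk : IsIdempotentElem (Ideal.Quotient.mkₐ A p k.val) := k.isIdempotentElem_val.map _
    rcases IsIdempotentElem.iff_eq_zero_or_one.1 hk with h | h
    · rw [h]; exact zero_mem _
    · rw [h]; exact one_mem _
  let E := AlgEquiv.ofBijective (Algebra.ofId A (S ⧸ p)) ⟨hinj, hsurj⟩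
  let φ : S →ₐ[A] A := (E.symm : (S ⧸ p) →ₐ[A] A).comp (Ideal.Quotient.mkₐ A p)
  refine ⟨φ, (map_idem_eq_zero_or_one φ e).resolve_left fun h => hep ?_⟩
  have h' : E.symm (Ideal.Quotient.mkₐ A p e.val) = 0 := h
  rw [map_eq_zero_iff _ E.symm.injective] at h'
  exact Ideal.Quotient.eq_zero_iff_mem.1 h'

variable [IsDomain A]

theorem map_inf_eq_one (e k : Idem S) (φ : S →ₐ[A] A) :
    φ (e ⊓ k).val = 1 ↔ φ e.val = 1 ∧ φ k.val = 1 := by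
  rw [Idem.val_inf, map_mul]
  rcases map_idem_eq_zero_or_one φ e with h | h <;> simp [h]

theorem map_compl_eq_one (e : Idem S) (φ : S →ₐ[A] A) :
    φ (eᶜ).val = 1 ↔ ¬ φ e.val = 1 := by
  rw [Idem.val_compl, map_sub, map_one]
  rcases map_idem_eq_zero_or_one φ e with h | h <;> simp [h]

theorem map_finset_sup_eq_one {ι : Type*} (F : Finset ι) (x : ι → Idem S)
    (φ : S →ₐ[A] A) : φ (F.sup x).val = 1 ↔ ∃ i ∈ F, φ (x i).val = 1 := by
  classical
  induction F using Finset.induction_on with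
  | empty => simp [Idem.val_bot]
  | insert a F ha ih =>
    rw [Finset.sup_insert, Finset.exists_mem_insert, ← ih, Idem.val_sup, map_sub, map_add, map_mul]
    rcases map_idem_eq_zero_or_one φ (x a) with h | h <;> simp [h]

/-- The images of the pieces are `0` or `1`, orthogonal and of sum `1`, so exactly one is `1`. Its
index depends on `φ` only, not on the coefficients. -/
theorem map_decomposition {ι : Type} [Fintype ι] {e : ι → Idem S}
    (ho : ∀ i j, i ≠ j → (e i).val * (e j).val = 0) (h1 : ∑ i, (e i).val = 1)
    (φ : S →ₐ[A] A) : ∃ i, ∀ a : ι → A, φ (∑ j, a j • (e j).val) = a i := by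
  classical
  obtain ⟨i, hi⟩ : ∃ i, φ (e i).val ≠ 0 := by
    by_contra! h
    have := congrArg φ h1
    rw [map_sum, Finset.sum_eq_zero fun i _ => h i, map_one] at this
    exact zero_ne_one this
  have hi1 := (map_idem_eq_zero_or_one φ (e i)).resolve_left hi
  refine ⟨i, fun a => ?_⟩
  rw [map_sum, Finset.sum_eq_single i]
  · rw [map_smul, hi1, smul_eq_mul, mul_one]
  · intro j _ hj
    have := congrArg φ (ho j i hj)
    rw [map_mul, hi1, mul_one, map_zero] at this
    rw [map_smul, this, smul_zero]
  · simp

/-- The `A`-valued homomorphisms of a Specker algebra separate its points. -/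
theorem ext_algHom (hS : IsSpeckerAlgebra A S) {s t : S}
    (h : ∀ φ : S →ₐ[A] A, φ s = φ t) : s = t := by
  obtain ⟨B, hf, hB⟩ := hS
  rw [← sub_eq_zero]
  obtain ⟨ι, _, e, a, heB, heo, he1, hs⟩ := exists_decomposition hB (s - t)
  rw [hs]
  refine Finset.sum_eq_zero fun i _ => ?_
  by_cases hi : e i = ⊥
  · rw [hi, Idem.val_bot, smul_zero]
  · obtain ⟨φ, hφ⟩ := exists_algHom_eq_one hB (e i) (hf _ (heB i) hi)
    -- Multiplication by `e i` isolates the coefficient `a i`.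
    have h0 : φ ((s - t) * (e i).val) = 0 := by rw [map_mul, map_sub, h φ, sub_self, zero_mul]
    rw [hs, Finset.sum_mul, Finset.sum_eq_single i, smul_mul_assoc,
      (e i).isIdempotentElem_val.eq, map_smul, hφ, smul_eq_mul, mul_one] at h0
    · rw [h0, zero_smul]
    · intro j _ hj
      rw [smul_mul_assoc, heo j i hj, smul_zero]
    · simp

/-- A binary operation on `A` acts pointwise on a Specker `A`-algebra. -/
theorem exists_map₂ (hS : IsSpeckerAlgebra A S) (f : A → A → A) (s t : S) :
    ∃ u : S, ∀ φ : S →ₐ[A] A, φ u = f (φ s) (φ t) := by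
  obtain ⟨B, hf, hB⟩ := hS
  obtain ⟨ι, _, e, a, heB, heo, he1, hs⟩ := exists_decomposition hB s
  obtain ⟨κ, _, k, b, hkB, hko, hk1, ht⟩ := exists_decomposition hB t
  refine ⟨∑ i, (∑ j, f (a i) (b j) • (k j).val) * (e i).val, fun φ => ?_⟩
  obtain ⟨i, hi⟩ := map_decomposition heo he1 φ
  obtain ⟨j, hj⟩ := map_decomposition hko hk1 φ
  have : φ (∑ i, (∑ j, f (a i) (b j) • (k j).val) * (e i).val)
      = φ (∑ i, f (a i) (b j) • (e i).val) := by
    simp only [map_sum φ, map_mul, map_smul φ, smul_eq_mul]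
    refine Finset.sum_congr rfl fun i _ => ?_
    have := hj fun j => f (a i) (b j)
    simp only [map_sum φ, map_smul φ, smul_eq_mul] at this
    rw [this]
  rw [this, hi, hs, ht, hi, hj]

theorem exists_values (hS : IsSpeckerAlgebra A S) (s : S) :
    ∃ V : Finset A, ∀ φ : S →ₐ[A] A, φ s ∈ V := by
  classical
  obtain ⟨B, hf, hB⟩ := hS
  obtain ⟨ι, _, e, a, heB, heo, he1, hs⟩ := exists_decomposition hB s
  refine ⟨Finset.univ.image a, fun φ => ?_⟩
  obtain ⟨i, hi⟩ := map_decomposition heo he1 φ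
  rw [hs, hi]
  simp

theorem exists_idem (hS : IsSpeckerAlgebra A S) (p : A → Prop) [DecidablePred p] (s : S) :
    ∃ e : Idem S, ∀ φ : S →ₐ[A] A, φ e.val = if p (φ s) then 1 else 0 := by
  obtain ⟨u, hu⟩ := hS.exists_map₂ (fun x _ => if p x then 1 else 0) s s
  refine ⟨⟨u, hS.ext_algHom fun φ => ?_⟩, hu⟩
  rw [map_mul, hu]
  split_ifs <;> simp

theorem idem_le_iff (hS : IsSpeckerAlgebra A S) {e k : Idem S} :
    e ≤ k ↔ ∀ φ : S →ₐ[A] A, φ e.val = 1 → φ k.val = 1 := by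
  rw [Idem.le_iff]
  refine ⟨fun h φ he => ?_, fun h => hS.ext_algHom fun φ => ?_⟩
  · rw [← h, map_mul] at he
    rcases map_idem_eq_zero_or_one φ k with hk | hk
    · simp [hk] at he
    · exact hk
  · rw [map_mul]
    rcases map_idem_eq_zero_or_one φ e with he | he
    · rw [he, zero_mul]
    · rw [h φ he, mul_one]

end IsSpeckerAlgebra

/-! ### The order is forced to be pointwise. -/

namespace IsTorsionFreeFAlgebra

variable {A S : Type*} [CommRing A] [LinearOrder A] [CommRing S] [Algebra A S] [Lattice S]

theorem addLeftMono (hL : IsTorsionFreeFAlgebra A S) : AddLeftMono S :=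
  ⟨fun r s t h => by simpa [add_comm] using hL.add_le_add_right s t r h⟩

/-- Two applications of the `f`-ring axiom to `s⁺ ⊓ s⁻ = 0` give `s⁺ * s⁻ = 0`, so `s * s` is the
sum of the squares of `s⁺` and `s⁻`. -/
theorem mul_self_nonneg (hL : IsTorsionFreeFAlgebra A S) (s : S) : 0 ≤ s * s := by
  have := hL.addLeftMono
  have h0 : s⁺ ⊓ s⁻ = 0 := posPart_inf_negPart_eq_zero s
  have h1 : (s⁺ * s⁻) ⊓ s⁻ = 0 := hL.mul_inf_eq_zero _ _ _ h0 (negPart_nonneg s)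
  have h2 : (s⁻ * s⁺) ⊓ (s⁺ * s⁻) = 0 :=
    hL.mul_inf_eq_zero _ _ _ (by rw [inf_comm, h1]) (posPart_nonneg s)
  rw [mul_comm s⁻, inf_idem] at h2
  have hs : s * s = s⁺ * s⁺ + s⁻ * s⁻ := by
    conv_lhs => rw [← posPart_sub_negPart s]
    linear_combination -2 * h2
  rw [hs]
  exact add_nonneg (hL.mul_nonneg _ _ (posPart_nonneg s) (posPart_nonneg s))
    (hL.mul_nonneg _ _ (negPart_nonneg s) (negPart_nonneg s))

theorem idem_nonneg (hL : IsTorsionFreeFAlgebra A S) (e : Idem S) : 0 ≤ e.val := by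
  rw [← e.isIdempotentElem_val.eq]
  exact hL.mul_self_nonneg _

variable [IsStrictOrderedRing A]

/-- The order of a Specker algebra that is a torsion-free `f`-algebra is the pointwise order. -/
theorem le_iff (hL : IsTorsionFreeFAlgebra A S) (hS : IsSpeckerAlgebra A S) {s t : S} :
    s ≤ t ↔ ∀ φ : S →ₐ[A] A, φ s ≤ φ t := by
  classical
  have := hL.addLeftMono
  rw [← sub_nonneg]
  have hsub : (∀ φ : S →ₐ[A] A, φ s ≤ φ t) ↔ ∀ φ : S →ₐ[A] A, 0 ≤ φ (t - s) := by
    simp only [map_sub, sub_nonneg]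
  rw [hsub]
  generalize t - s = u
  constructor
  · intro hu φ
    by_contra! hφ
    -- On the level set `e = [u = φ u]`, the product `u * e` is both nonnegative and a negative
    -- multiple of `e`; torsion-freeness gives `e = 0`, although `φ e = 1`.
    obtain ⟨e, he⟩ := hS.exists_idem (fun x => x = φ u) u
    have hmul : u * e.val = φ u • e.val := hS.ext_algHom fun ψ => by
      rw [map_mul, map_smul, he, smul_eq_mul]
      split_ifs with h
      · rw [h]
      · simp
    have h1 : 0 ≤ φ u • e.val := hmul ▸ hL.mul_nonneg _ _ hu (hL.idem_nonneg e)
    have h2 : 0 ≤ -(φ u • e.val) := by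
      rw [← neg_smul]
      exact hL.smul_nonneg _ _ (neg_nonneg.2 hφ.le) (hL.idem_nonneg e)
    rcases hL.torsion_free _ _ (le_antisymm (neg_nonneg.1 h2) h1) with h | h
    · exact hφ.ne h
    · have := he φ
      rw [h, map_zero, if_pos rfl] at this
      exact zero_ne_one this
  · intro h
    obtain ⟨V, hV⟩ := hS.exists_values u
    choose e he using fun a : A => hS.exists_idem (fun x => x = a) u
    have hu : u = ∑ a ∈ V with 0 ≤ a, a • (e a).val := hS.ext_algHom fun φ => by
      simp only [map_sum, map_smul, he, smul_eq_mul, mul_ite, mul_one, mul_zero]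
      rw [Finset.sum_ite_eq, if_pos (Finset.mem_filter.2 ⟨hV φ, h φ⟩)]
    rw [hu]
    exact Finset.sum_nonneg fun a ha =>
      hL.smul_nonneg _ _ (Finset.mem_filter.1 ha).2 (hL.idem_nonneg _)

theorem map_inf (hL : IsTorsionFreeFAlgebra A S) (hS : IsSpeckerAlgebra A S) (φ : S →ₐ[A] A)
    (s t : S) : φ (s ⊓ t) = min (φ s) (φ t) := by
  obtain ⟨u, hu⟩ := hS.exists_map₂ min s t
  rw [← hu φ]
  congr 1
  apply le_antisymm
  · rw [hL.le_iff hS]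
    intro ψ
    rw [hu]
    exact le_min ((hL.le_iff hS).1 inf_le_left ψ) ((hL.le_iff hS).1 inf_le_right ψ)
  · refine le_inf ((hL.le_iff hS).2 fun ψ => ?_) ((hL.le_iff hS).2 fun ψ => ?_) <;> rw [hu]
    exacts [min_le_left _ _, min_le_right _ _]

end IsTorsionFreeFAlgebra

/-! ### Existence of the order. -/

namespace IsSpeckerAlgebra

variable {A S : Type*} [CommRing A] [LinearOrder A] [IsStrictOrderedRing A] [CommRing S]
  [Algebra A S]

theorem exists_lattice (hS : IsSpeckerAlgebra A S) :
    ∃ L : Lattice S, @IsTorsionFreeFAlgebra A S _ _ _ _ L := by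
  choose sup hsup using hS.exists_map₂ max
  choose inf hinf using hS.exists_map₂ min
  let L : Lattice S :=
    { le := fun s t => ∀ φ : S →ₐ[A] A, φ s ≤ φ t
      le_refl := fun s φ => le_rfl
      le_trans := fun s t u h h' φ => (h φ).trans (h' φ)
      le_antisymm := fun s t h h' => hS.ext_algHom fun φ => (h φ).antisymm (h' φ)
      sup := sup
      le_sup_left := fun s t φ => by rw [hsup]; exact le_max_left _ _
      le_sup_right := fun s t φ => by rw [hsup]; exact le_max_right _ _
      sup_le := fun s t u h h' φ => by rw [hsup]; exact max_le (h φ) (h' φ)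
      inf := inf
      inf_le_left := fun s t φ => by rw [hinf]; exact min_le_left _ _
      inf_le_right := fun s t φ => by rw [hinf]; exact min_le_right _ _
      le_inf := fun s t u h h' φ => by rw [hinf]; exact le_min (h φ) (h' φ) }
  have nonneg : ∀ s : S, 0 ≤ s ↔ ∀ φ : S →ₐ[A] A, 0 ≤ φ s := fun s => by
    change (∀ φ : S →ₐ[A] A, φ 0 ≤ φ s) ↔ _
    simp only [map_zero]
  refine ⟨L, ?_, ?_, ?_, ?_, ?_⟩
  · intro s t r h φ
    rw [map_add, map_add]
    exact add_le_add_left (h φ) _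
  · intro s t hs ht
    rw [nonneg] at *
    intro φ
    rw [map_mul]
    exact mul_nonneg (hs φ) (ht φ)
  · intro a s ha hs
    rw [nonneg] at *
    intro φ
    rw [map_smul]
    exact mul_nonneg ha (hs φ)
  · intro s t r h hr
    rw [nonneg] at hr
    refine hS.ext_algHom fun φ => (hinf _ _ φ).trans ?_
    have h' : min (φ s) (φ t) = 0 := by rw [← map_zero φ, ← h]; exact (hinf s t φ).symm
    have hs : 0 ≤ φ s := h' ▸ min_le_left _ _
    have ht : 0 ≤ φ t := h' ▸ min_le_right _ _
    rw [map_mul, map_zero]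
    rcases min_choice (φ s) (φ t) with h0 | h0
    · rw [← h0, h', zero_mul, min_eq_left ht]
    · rw [← h0, h', min_eq_right (mul_nonneg hs (hr φ))]
  · intro a s h
    refine or_iff_not_imp_left.2 fun ha => hS.ext_algHom fun φ => ?_
    have := congrArg φ h
    rw [map_smul, map_zero, smul_eq_mul, mul_eq_zero] at this
    rw [map_zero]
    exact this.resolve_left ha

theorem existsUnique_lattice (hS : IsSpeckerAlgebra A S) :
    ∃! L : Lattice S, @IsTorsionFreeFAlgebra A S _ _ _ _ L := by
  obtain ⟨L, hL⟩ := hS.exists_lattice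
  exact ⟨L, hL, fun L' hL' => Lattice.ext fun s t =>
    (@IsTorsionFreeFAlgebra.le_iff A S _ _ _ _ L' _ hL' hS s t).trans
      (@IsTorsionFreeFAlgebra.le_iff A S _ _ _ _ L _ hL hS s t).symm⟩

end IsSpeckerAlgebra

/-! ### Boolean proximities. -/

namespace IsBooleanProximity

variable {B : Type*} [BooleanAlgebra B] {R : B → B → Prop}

theorem top_right (hR : IsBooleanProximity R) (a : B) : R a ⊤ :=
  hR.dv3 _ _ _ _ le_top hR.dv1 le_rfl

theorem bot_left (hR : IsBooleanProximity R) (a : B) : R ⊥ a := by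
  have := hR.dv5 _ _ hR.dv1
  rw [compl_top] at this
  exact hR.dv3 _ _ _ _ le_rfl this bot_le

theorem inf (hR : IsBooleanProximity R) {a b c d : B} (h : R a b) (h' : R c d) :
    R (a ⊓ c) (b ⊓ d) :=
  hR.dv4 _ _ _ (hR.dv3 _ _ _ _ inf_le_left h le_rfl) (hR.dv3 _ _ _ _ inf_le_right h' le_rfl)

theorem sup_left (hR : IsBooleanProximity R) {a b c : B} (h : R a c) (h' : R b c) :
    R (a ⊔ b) c := by
  have := hR.dv5 _ _ (hR.dv4 _ _ _ (hR.dv5 _ _ h) (hR.dv5 _ _ h'))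
  rwa [compl_inf, compl_compl, compl_compl, compl_compl] at this

theorem finset_sup_left (hR : IsBooleanProximity R) {ι : Type*} (F : Finset ι) (x : ι → B)
    {b : B} (h : ∀ i ∈ F, R (x i) b) : R (F.sup x) b :=
  Finset.sup_induction (p := fun a => R a b) (hR.bot_left b) (fun _ h _ h' => hR.sup_left h h') h

end IsBooleanProximity

/-! ### Level idempotents and the extension of a proximity. -/

namespace IsSpeckerAlgebra

variable {A S : Type*} [CommRing A] [LinearOrder A] [IsStrictOrderedRing A] [CommRing S]
  [Algebra A S]

/-- The idempotent `[s ≥ a]` of a Specker algebra. -/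
noncomputable def level (hS : IsSpeckerAlgebra A S) (s : S) (a : A) : Idem S :=
  (hS.exists_idem (fun x => a ≤ x) s).choose

theorem map_level (hS : IsSpeckerAlgebra A S) (s : S) (a : A) (φ : S →ₐ[A] A) :
    φ (hS.level s a).val = if a ≤ φ s then 1 else 0 :=
  (hS.exists_idem (fun x => a ≤ x) s).choose_spec φ

theorem map_level_eq_one (hS : IsSpeckerAlgebra A S) {s : S} {a : A} {φ : S →ₐ[A] A} :
    φ (hS.level s a).val = 1 ↔ a ≤ φ s := by
  rw [hS.map_level]
  split_ifs with h <;> simp [h]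

theorem idem_ext (hS : IsSpeckerAlgebra A S) {e k : Idem S}
    (h : ∀ φ : S →ₐ[A] A, φ e.val = 1 ↔ φ k.val = 1) : e = k :=
  le_antisymm (hS.idem_le_iff.2 fun φ => (h φ).1) (hS.idem_le_iff.2 fun φ => (h φ).2)

theorem level_le_level (hS : IsSpeckerAlgebra A S) {s t : S} {a b : A}
    (h : ∀ φ : S →ₐ[A] A, a ≤ φ s → b ≤ φ t) : hS.level s a ≤ hS.level t b :=
  hS.idem_le_iff.2 fun φ => by simpa only [hS.map_level_eq_one] using h φ

theorem level_eq_top (hS : IsSpeckerAlgebra A S) {s : S} {a : A}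
    (h : ∀ φ : S →ₐ[A] A, a ≤ φ s) : hS.level s a = ⊤ :=
  hS.idem_ext fun φ => by simp [hS.map_level_eq_one, h φ, Idem.val_top]

theorem level_eq_bot (hS : IsSpeckerAlgebra A S) {s : S} {a : A}
    (h : ∀ φ : S →ₐ[A] A, φ s < a) : hS.level s a = ⊥ :=
  hS.idem_ext fun φ => by simp [hS.map_level_eq_one, h φ, Idem.val_bot]

theorem level_idem (hS : IsSpeckerAlgebra A S) (e : Idem S) {a : A} (h0 : 0 < a) (h1 : a ≤ 1) :
    hS.level e.val a = e :=
  hS.idem_ext fun φ => by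
    rw [hS.map_level_eq_one]
    rcases map_idem_eq_zero_or_one φ e with h | h <;> simp [h, h0, h1]

variable {R : Idem S → Idem S → Prop}

/-- A proximity holds for `e` and `k` as soon as `e` is covered by finitely many elements
proximal to `k`. -/
theorem rel_of_cover (hS : IsSpeckerAlgebra A S) (hR : IsBooleanProximity R) {ι : Type*}
    (F : Finset ι) (x : ι → Idem S) {e k : Idem S} (hx : ∀ i ∈ F, R (x i) k)
    (he : ∀ φ : S →ₐ[A] A, φ e.val = 1 → ∃ i ∈ F, φ (x i).val = 1) : R e k :=
  hR.dv3 _ _ _ _ (hS.idem_le_iff.2 fun φ h => (map_finset_sup_eq_one F x φ).2 (he φ h))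
    (hR.finset_sup_left F x hx) le_rfl

/-- The extension of a relation between idempotents to a Specker algebra. -/
def extend (hS : IsSpeckerAlgebra A S) (R : Idem S → Idem S → Prop) (s t : S) : Prop :=
  ∀ a : A, R (hS.level s a) (hS.level t a)

/-- If the idempotents `[s ≥ b]` that cover `e` satisfy `[t ≥ b] ≤ k`, then `e` is
proximal to `k`. -/
theorem rel_of_extend (hS : IsSpeckerAlgebra A S) (hR : IsBooleanProximity R) {s t : S}
    (h : hS.extend R s t) {e k : Idem S} (p : A → Prop)
    (he : ∀ φ : S →ₐ[A] A, φ e.val = 1 → p (φ s))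
    (hk : ∀ b, p b → ∀ φ : S →ₐ[A] A, b ≤ φ t → φ k.val = 1) : R e k := by
  classical
  obtain ⟨V, hV⟩ := hS.exists_values s
  -- The values of `s` satisfying `p` suffice: where `e` is `1`, the level at `φ s` covers.
  refine hS.rel_of_cover hR (V.filter p) (hS.level s) (fun b hb => ?_) fun φ hφ =>
    ⟨φ s, Finset.mem_filter.2 ⟨hV φ, he φ hφ⟩, hS.map_level_eq_one.2 le_rfl⟩
  refine hR.dv3 _ _ _ _ le_rfl (h b) (hS.idem_le_iff.2 fun φ hφ => ?_)
  exact hk b (Finset.mem_filter.1 hb).2 φ (hS.map_level_eq_one.1 hφ)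

theorem rel_of_extend₂ (hS : IsSpeckerAlgebra A S) (hR : IsBooleanProximity R) {s t r u : S}
    (h : hS.extend R s t) (h' : hS.extend R r u) {e k : Idem S} (p : A → A → Prop)
    (he : ∀ φ : S →ₐ[A] A, φ e.val = 1 → p (φ s) (φ r))
    (hk : ∀ b c, p b c → ∀ φ : S →ₐ[A] A, b ≤ φ t → c ≤ φ u → φ k.val = 1) : R e k := by
  classical
  obtain ⟨V, hV⟩ := hS.exists_values s
  obtain ⟨W, hW⟩ := hS.exists_values r
  refine hS.rel_of_cover hR ((V ×ˢ W).filter fun q => p q.1 q.2)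
    (fun q => hS.level s q.1 ⊓ hS.level r q.2) (fun q hq => ?_) fun φ hφ =>
    ⟨(φ s, φ r), Finset.mem_filter.2 ⟨Finset.mem_product.2 ⟨hV φ, hW φ⟩, he φ hφ⟩, ?_⟩
  · refine hR.dv3 _ _ _ _ le_rfl (hR.inf (h q.1) (h' q.2)) (hS.idem_le_iff.2 fun φ hφ => ?_)
    rw [map_inf_eq_one, hS.map_level_eq_one, hS.map_level_eq_one] at hφ
    exact hk _ _ (Finset.mem_filter.1 hq).2 φ hφ.1 hφ.2
  · rw [map_inf_eq_one, hS.map_level_eq_one, hS.map_level_eq_one]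
    exact ⟨le_rfl, le_rfl⟩

/-- The element `⋁ b • c b`, over `b ∈ F`, of a Specker algebra, with `m` as a lower bound. -/
theorem exists_staircase (hS : IsSpeckerAlgebra A S) (m : A) (F : Finset A) (c : A → Idem S) :
    ∃ v : S, ∀ (φ : S →ₐ[A] A) (a : A), a ≤ φ v ↔ a ≤ m ∨ ∃ b ∈ F, a ≤ b ∧ φ (c b).val = 1 := by
  classical
  induction F using Finset.induction_on with
  | empty => exact ⟨algebraMap A S m, fun φ a => by simp⟩
  | insert b F hb ih =>
    obtain ⟨v, hv⟩ := ih
    obtain ⟨w, hw⟩ := hS.exists_map₂ (fun x y => if y = 1 then max x b else x) v (c b).val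
    refine ⟨w, fun φ a => ?_⟩
    rw [hw, Finset.exists_mem_insert]
    split_ifs with h
    · rw [le_max_iff, hv, and_iff_left h, or_assoc, or_comm (b := a ≤ b)]
    · rw [hv]
      tauto

/-- Interpolants `c a` between `[s ≥ a]` and `[t ≥ a]`, chosen separately, need not decrease in `a`.
The staircase repairs this: for `a > m`, `[v ≥ a]` is the join of the `c b` with `b ≥ a` a value of
`s`. -/
theorem extend_interpolate (hS : IsSpeckerAlgebra A S) (hR : IsBooleanProximity R) {s t : S}
    (h : hS.extend R s t) : ∃ v, hS.extend R s v ∧ hS.extend R v t := by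
  classical
  obtain ⟨V, hV⟩ := hS.exists_values s
  obtain ⟨W, hW⟩ := hS.exists_values t
  obtain ⟨m, hm⟩ := (V ∪ W).finite_toSet.bddBelow
  choose c hc using fun a => hR.dv6 _ _ (h a)
  obtain ⟨v, hv⟩ := hS.exists_staircase m V c
  refine ⟨v, fun a => ?_, fun a => ?_⟩
  · refine hS.rel_of_cover hR (V.filter (a ≤ ·)) (hS.level s) (fun b hb => ?_) fun φ hφ =>
      ⟨φ s, Finset.mem_filter.2 ⟨hV φ, hS.map_level_eq_one.1 hφ⟩, hS.map_level_eq_one.2 le_rfl⟩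
    refine hR.dv3 _ _ _ _ le_rfl (hc b).1 (hS.idem_le_iff.2 fun φ hφ => ?_)
    rw [Finset.mem_filter] at hb
    rw [hS.map_level_eq_one, hv]
    exact Or.inr ⟨b, hb.1, hb.2, hφ⟩
  · by_cases ha : a ≤ m
    · rw [hS.level_eq_top fun φ => ha.trans (hm (Finset.mem_union_right _ (hW φ)))]
      exact hR.top_right _
    · refine hS.rel_of_cover hR (V.filter (a ≤ ·)) c (fun b hb => ?_) fun φ hφ => ?_
      · exact hR.dv3 _ _ _ _ le_rfl (hc b).2
          (hS.level_le_level fun φ hφ => (Finset.mem_filter.1 hb).2.trans hφ)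
      · rw [hS.map_level_eq_one, hv] at hφ
        obtain ⟨b, hb, hab, hcb⟩ := hφ.resolve_left ha
        exact ⟨b, Finset.mem_filter.2 ⟨hb, hab⟩, hcb⟩

/-- For idempotent `e`, `[e ≥ a]` is `⊤` if `a ≤ 0`, `e` if `0 < a ≤ 1`, and `⊥` if `a > 1`. -/
theorem restrictToIdem_extend (hS : IsSpeckerAlgebra A S) (hR : IsBooleanProximity R) :
    restrictToIdem (hS.extend R) = R := by
  funext e k
  refine propext ⟨fun h => ?_, fun h a => ?_⟩
  · have := h 1
    rwa [hS.level_idem e one_pos le_rfl, hS.level_idem k one_pos le_rfl] at this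
  · have hk : ∀ φ : S →ₐ[A] A, 0 ≤ φ k.val := fun φ => by
      rcases map_idem_eq_zero_or_one φ k with h | h <;> simp [h]
    have he : ∀ φ : S →ₐ[A] A, φ e.val ≤ 1 := fun φ => by
      rcases map_idem_eq_zero_or_one φ e with h | h <;> simp [h]
    rcases le_or_gt a 0 with h0 | h0
    · rw [hS.level_eq_top fun φ => h0.trans (hk φ)]
      exact hR.top_right _
    · rcases le_or_gt a 1 with h1 | h1
      · rwa [hS.level_idem e h0 h1, hS.level_idem k h0 h1]
      · rw [hS.level_eq_bot fun φ => (he φ).trans_lt h1]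
        exact hR.bot_left _

theorem isAlgebraProximity_extend [Lattice S] (hS : IsSpeckerAlgebra A S)
    (hL : IsTorsionFreeFAlgebra A S) (hR : IsBooleanProximity R) :
    IsAlgebraProximity A (hS.extend R) := by
  have hnn : ∀ {s : S}, 0 ≤ s → ∀ φ : S →ₐ[A] A, 0 ≤ φ s := fun hs φ => by
    simpa using (hL.le_iff hS).1 hs φ
  have hconst : ∀ m : A, hS.extend R (algebraMap A S m) (algebraMap A S m) := fun m a => by
    rcases le_or_gt a m with h | h
    · rw [hS.level_eq_top fun φ => by simpa using h]
      exact hR.dv1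
    · rw [hS.level_eq_bot fun φ => by simpa using h]
      exact hR.bot_left _
  refine ⟨?_, ?_, ?_, ?_, ?_, ?_, ?_, ?_, ?_, ?_, ?_, ?_⟩
  · simpa using hconst 0
  · simpa using hconst 1
  · intro s t h
    refine (hL.le_iff hS).2 fun φ => hS.map_level_eq_one.1 ?_
    exact hS.idem_le_iff.1 (hR.dv2 _ _ (h (φ s))) φ (hS.map_level_eq_one.2 le_rfl)
  · intro s t r u h h' h'' a
    rw [hL.le_iff hS] at h h''
    exact hR.dv3 _ _ _ _ (hS.level_le_level fun φ hφ => hφ.trans (h φ)) (h' a)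
      (hS.level_le_level fun φ hφ => hφ.trans (h'' φ))
  · intro s t r h h' a
    have : hS.level (t ⊓ r) a = hS.level t a ⊓ hS.level r a := hS.idem_ext fun φ => by
      rw [map_inf_eq_one, hS.map_level_eq_one, hS.map_level_eq_one, hS.map_level_eq_one,
        hL.map_inf hS, le_min_iff]
    rw [this]
    exact hR.dv4 _ _ _ (h a) (h' a)
  · intro s t h a
    -- The complement of `[-s ≥ a]` is `[s > -a]`, a finite join of levels of `s`.
    have : R (hS.level (-s) a)ᶜ (hS.level (-t) a)ᶜ := by
      refine hS.rel_of_extend hR h (fun b => -a < b) (fun φ hφ => ?_) fun b hb φ hφ => ?_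
      · rw [map_compl_eq_one, hS.map_level_eq_one, map_neg] at hφ
        exact neg_lt.1 (not_le.1 hφ)
      · rw [map_compl_eq_one, hS.map_level_eq_one, map_neg, not_le]
        exact neg_lt.1 (hb.trans_le hφ)
    simpa only [compl_compl] using hR.dv5 _ _ this
  · intro s t r u h h' a
    refine hS.rel_of_extend₂ hR h h' (fun b c => a ≤ b + c) (fun φ hφ => ?_)
      fun b c hbc φ hb hc => ?_
    · rwa [hS.map_level_eq_one, map_add] at hφ
    · rw [hS.map_level_eq_one, map_add]
      exact hbc.trans (add_le_add hb hc)
  · intro s t h a ha b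
    refine hS.rel_of_extend hR h (fun x => b ≤ a * x) (fun φ hφ => ?_) fun x hx φ hφ => ?_
    · rwa [hS.map_level_eq_one, map_smul] at hφ
    · rw [hS.map_level_eq_one, map_smul]
      exact hx.trans (mul_le_mul_of_nonneg_left hφ ha.le)
  · intro s t a ha h b
    have : ∀ s : S, hS.level (a • s) (a * b) = hS.level s b := fun s => hS.idem_ext fun φ => by
      rw [hS.map_level_eq_one, hS.map_level_eq_one, map_smul, smul_eq_mul,
        mul_le_mul_iff_right₀ ha]
    simpa only [this] using h (a * b)
  · intro s t r u hs ht hr hu h h' a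
    -- The signs are recorded because `b ≤ φ t` and `c ≤ φ u` bound `b * c` only with nonnegativity.
    refine hS.rel_of_extend₂ hR h h' (fun b c => 0 ≤ b ∧ 0 ≤ c ∧ a ≤ b * c) (fun φ hφ => ?_)
      fun b c hbc φ hb hc => ?_
    · rw [hS.map_level_eq_one, map_mul] at hφ
      exact ⟨hnn hs φ, hnn hr φ, hφ⟩
    · rw [hS.map_level_eq_one, map_mul]
      exact hbc.2.2.trans (mul_le_mul hb hc hbc.2.1 (hnn ht φ))
  · intro s t h
    exact hS.extend_interpolate hR h
  · intro s hs
    obtain ⟨φ, hφ⟩ : ∃ φ : S →ₐ[A] A, φ s ≠ 0 := by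
      by_contra! h
      exact hs.ne' (hS.ext_algHom fun φ => by rw [h φ, map_zero])
    have hpos : 0 < φ s := (hnn hs.le φ).lt_of_ne' hφ
    -- The witness for P10 is `φ s • k` with `k ≺ [s ≥ φ s]`: its levels in `(0, φ s]` all equal
    -- `k`.
    obtain ⟨k, hk0, hk⟩ := hR.dv7 (hS.level s (φ s)) fun h => by
      have := (hS.map_level_eq_one (s := s) (φ := φ)).2 le_rfl
      rw [h, Idem.val_bot, map_zero] at this
      exact zero_ne_one this
    have hks : ∀ ψ : S →ₐ[A] A, ψ (φ s • k.val) = if ψ k.val = 1 then φ s else 0 := fun ψ => by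
      rw [map_smul]
      rcases map_idem_eq_zero_or_one ψ k with h | h <;> simp [h]
    refine ⟨φ s • k.val, lt_of_le_of_ne ((hL.le_iff hS).2 fun ψ => ?_) fun h => ?_, fun b => ?_⟩
    · rw [map_zero, hks]
      split_ifs
      exacts [hpos.le, le_rfl]
    · refine hk0 (Idem.ext ((hL.torsion_free _ _ h.symm).resolve_left hφ))
    · rcases le_or_gt b 0 with h0 | h0
      · rw [hS.level_eq_top fun ψ => h0.trans (hnn hs.le ψ)]
        exact hR.top_right _
      · by_cases hb : b ≤ φ s
        · refine hR.dv3 _ _ _ _ (hS.idem_le_iff.2 fun ψ hψ => ?_) hk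
            (hS.level_le_level fun ψ hψ => hb.trans hψ)
          rw [hS.map_level_eq_one, hks] at hψ
          by_contra h
          rw [if_neg h] at hψ
          exact h0.not_ge hψ
        · rw [hS.level_eq_bot fun ψ => ?_]
          · exact hR.bot_left _
          · rw [hks]
            split_ifs
            exacts [not_le.1 hb, h0]

end IsSpeckerAlgebra

/-! ### Proximities on `S` are determined by idempotents. -/

namespace IsAlgebraProximity

variable {A S : Type*} [CommRing A] [LinearOrder A] [CommRing S]
  [Algebra A S] [Lattice S] {P : S → S → Prop}

theorem inf_const (hP : IsAlgebraProximity A P) {s t c : S} (hc : P c c) (h : P s t) :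
    P (s ⊓ c) (t ⊓ c) :=
  hP.p4 _ _ _ (hP.p3 _ _ _ _ inf_le_left h le_rfl) (hP.p3 _ _ _ _ inf_le_right hc le_rfl)

variable [IsStrictOrderedRing A]

theorem algebraMap_self (hP : IsAlgebraProximity A P) (a : A) :
    P (algebraMap A S a) (algebraMap A S a) := by
  rcases lt_trichotomy a 0 with h | rfl | h
  · have := hP.p5 _ _ (hP.p7 _ _ hP.p1_one (-a) (neg_pos.2 h))
    simpa [Algebra.algebraMap_eq_smul_one] using this
  · simpa using hP.p1_zero
  · simpa [Algebra.algebraMap_eq_smul_one] using hP.p7 _ _ hP.p1_one a h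

/-- Choose `b < a` with no value of `s` or `t` strictly between. Clipping to `[b, a]` and
subtracting `b` turns `s` into `(a - b) • [s ≥ a]`. These operations preserve the proximity, and the
cancellation half of P7 replaces division by `a - b`. -/
theorem level (hP : IsAlgebraProximity A P) (hS : IsSpeckerAlgebra A S)
    (hL : IsTorsionFreeFAlgebra A S) {s t : S} (h : P s t) (a : A) :
    P (hS.level s a).val (hS.level t a).val := by
  classical
  obtain ⟨V, hV⟩ := hS.exists_values s
  obtain ⟨W, hW⟩ := hS.exists_values t
  obtain ⟨b, hba, hb⟩ : ∃ b < a, ∀ x ∈ V ∪ W, x ≤ b ∨ a ≤ x := by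
    -- The element `a - 1` serves when no value lies below `a`.
    let F := insert (a - 1) ((V ∪ W).filter (· < a))
    have hF : F.Nonempty := Finset.insert_nonempty _ _
    refine ⟨F.max' hF, (Finset.max'_lt_iff _ _).2 fun x hx => ?_, fun x hx => ?_⟩
    · rcases Finset.mem_insert.1 hx with rfl | hx
      · exact sub_one_lt a
      · exact (Finset.mem_filter.1 hx).2
    · refine or_iff_not_imp_right.2 fun hax => F.le_max' x ?_
      exact Finset.mem_insert_of_mem (Finset.mem_filter.2 ⟨hx, not_le.1 hax⟩)
  have clip : ∀ s : S, (∀ φ : S →ₐ[A] A, φ s ∈ V ∪ W) →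
      -- The join with `b` is written through negation and meet, the operations that P4 and P5
      -- control.
      -(-s ⊓ algebraMap A S (-b)) ⊓ algebraMap A S a + algebraMap A S (-b)
        = (a - b) • (hS.level s a).val := fun s hs => hS.ext_algHom fun φ => by
    have hneg : ∀ x : A, -min (-x) (-b) = max x b := fun x => by rw [min_neg_neg, neg_neg]
    rw [map_add, hL.map_inf hS, map_neg, hL.map_inf hS, map_neg, φ.commutes, φ.commutes,
      map_smul, hS.map_level, Algebra.algebraMap_self_apply, Algebra.algebraMap_self_apply, hneg]
    rcases hb _ (hs φ) with h | h
    · rw [max_eq_right h, min_eq_left hba.le, if_neg (h.trans_lt hba).not_ge]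
      simp
    · rw [max_eq_left (hba.le.trans h), min_eq_right h, if_pos h]
      simp [sub_eq_add_neg]
  refine hP.p7_cancel _ _ (a - b) (sub_pos.2 hba) ?_
  rw [← clip s fun φ => Finset.mem_union_left _ (hV φ),
    ← clip t fun φ => Finset.mem_union_right _ (hW φ)]
  refine hP.p6 _ _ _ _ (hP.inf_const (hP.algebraMap_self a) (hP.p5 _ _ ?_))
    (hP.algebraMap_self _)
  exact hP.inf_const (hP.algebraMap_self _) (hP.p5 _ _ h)

/-- Induction on the common values of `s` and `t` above the least one, `m`. With `b` the top value
and `M` the next, `s` is its truncation at `M` plus `(b - M) • [s ≥ b]`, and P6 and P7 reassemble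
the pieces. -/
theorem of_level (hP : IsAlgebraProximity A P) (hS : IsSpeckerAlgebra A S) (m : A) (F : Finset A) :
    ∀ s t : S, (∀ φ : S →ₐ[A] A, φ s ∈ insert m F) → (∀ φ : S →ₐ[A] A, φ t ∈ insert m F) →
      (∀ x ∈ F, m < x) → (∀ a : A, P (hS.level s a).val (hS.level t a).val) → P s t := by
  classical
  induction F using Finset.induction_on_max with
  | empty =>
    intro s t hs ht _ _
    have heq : ∀ s : S, (∀ φ : S →ₐ[A] A, φ s ∈ insert m (∅ : Finset A)) →
        s = algebraMap A S m := fun s hs => hS.ext_algHom fun φ => by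
      simpa using hs φ
    rw [heq s hs, heq t ht]
    exact hP.algebraMap_self m
  | insert b F hb ih =>
    intro s t hs ht hm h
    let M := (insert m F).max' (Finset.insert_nonempty _ _)
    have hMF : ∀ x ∈ insert m F, x ≤ M := fun x hx => Finset.le_max' _ _ hx
    have hMb : M < b := (Finset.max'_lt_iff _ _).2 fun x hx => by
      rcases Finset.mem_insert.1 hx with rfl | hx
      · exact hm b (Finset.mem_insert_self _ _)
      · exact hb x hx
    have cut : ∀ s : S, (∀ φ : S →ₐ[A] A, φ s ∈ insert m (insert b F)) →
        ∃ s' : S, (∀ φ : S →ₐ[A] A, φ s' ∈ insert m F) ∧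
          (∀ φ : S →ₐ[A] A, φ s' = min (φ s) M) ∧
          s = s' + (b - M) • (hS.level s b).val := fun s hs => by
      obtain ⟨s', hs'⟩ := hS.exists_map₂ (fun x _ => min x M) s s
      have key : ∀ φ : S →ₐ[A] A, φ s = b ∨ φ s ∈ insert m F := fun φ => by
        have := hs φ
        rw [Finset.insert_comm] at this
        exact Finset.mem_insert.1 this
      refine ⟨s', fun φ => ?_, hs', hS.ext_algHom fun φ => ?_⟩
      · rw [hs']
        rcases key φ with h | h
        · rw [h, min_eq_right hMb.le]
          exact Finset.max'_mem _ _
        · rwa [min_eq_left (hMF _ h)]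
      · rw [map_add, map_smul, hS.map_level, hs']
        rcases key φ with h | h
        · rw [h, min_eq_right hMb.le, if_pos le_rfl]
          simp
        · rw [min_eq_left (hMF _ h), if_neg ((hMF _ h).trans_lt hMb).not_ge]
          simp
    obtain ⟨s', hs'F, hs', hseq⟩ := cut s hs
    obtain ⟨t', ht'F, ht', hteq⟩ := cut t ht
    rw [hseq, hteq]
    refine hP.p6 _ _ _ _ (ih s' t' hs'F ht'F (fun x hx => hm x (Finset.mem_insert_of_mem hx))
      fun a => ?_) (hP.p7 _ _ (h b) _ (sub_pos.2 hMb))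
    -- Truncation at `M` leaves the levels up to `M` unchanged and makes the higher ones `⊥`.
    rcases le_or_gt a M with ha | ha
    · have hlev : ∀ s s' : S, (∀ φ : S →ₐ[A] A, φ s' = min (φ s) M) →
          hS.level s' a = hS.level s a := fun s s' h => hS.idem_ext fun φ => by
        rw [hS.map_level_eq_one, hS.map_level_eq_one, h, le_min_iff, and_iff_left ha]
      rw [hlev s s' hs', hlev t t' ht']
      exact h a
    · have hlev : ∀ s s' : S, (∀ φ : S →ₐ[A] A, φ s' = min (φ s) M) →
          hS.level s' a = ⊥ := fun s s' h => hS.level_eq_bot fun φ => by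
        rw [h]
        exact (min_le_right _ _).trans_lt ha
      rw [hlev s s' hs', hlev t t' ht']
      exact hP.p1_zero

/-- A proximity on a Specker algebra is determined by its restriction to idempotents. -/
theorem eq_extend (hP : IsAlgebraProximity A P) (hS : IsSpeckerAlgebra A S)
    (hL : IsTorsionFreeFAlgebra A S) : P = hS.extend (restrictToIdem P) := by
  classical
  funext s t
  refine propext ⟨fun h a => hP.level hS hL h a, fun h => ?_⟩
  obtain ⟨V, hV⟩ := hS.exists_values s
  obtain ⟨W, hW⟩ := hS.exists_values t
  obtain ⟨m, hm⟩ := (V ∪ W).finite_toSet.bddBelow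
  have hmem : ∀ x ∈ V ∪ W, x ∈ insert m ((V ∪ W).filter (m < ·)) := fun x hx => by
    rcases (hm hx).eq_or_lt with rfl | h
    · exact Finset.mem_insert_self _ _
    · exact Finset.mem_insert_of_mem (Finset.mem_filter.2 ⟨hx, h⟩)
  exact hP.of_level hS m _ s t (fun φ => hmem _ (Finset.mem_union_left _ (hV φ)))
    (fun φ => hmem _ (Finset.mem_union_right _ (hW φ))) (fun x hx => (Finset.mem_filter.1 hx).2) h

/-- The elements supplied by P9 and P10 need not be idempotent; passing to a level idempotent by
`level` makes them so. -/
theorem isBooleanProximity_restrictToIdem (hP : IsAlgebraProximity A P)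
    (hS : IsSpeckerAlgebra A S) (hL : IsTorsionFreeFAlgebra A S) :
    IsBooleanProximity (restrictToIdem P) := by
  have hle : ∀ {e k : Idem S}, e ≤ k ↔ e.val ≤ k.val := fun {e k} => by
    rw [hL.le_iff hS, hS.idem_le_iff]
    refine forall_congr' fun φ => ?_
    rcases IsSpeckerAlgebra.map_idem_eq_zero_or_one φ e with h | h <;>
      rcases IsSpeckerAlgebra.map_idem_eq_zero_or_one φ k with h' | h' <;> simp [h, h']
  refine ⟨hP.p1_one, fun e k h => hle.2 (hP.p2 _ _ h), ?_, ?_, ?_, ?_, ?_⟩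
  · intro a b c d h h' h''
    exact hP.p3 _ _ _ _ (hle.1 h) h' (hle.1 h'')
  · intro a b c h h'
    have : (b ⊓ c).val = b.val ⊓ c.val := hS.ext_algHom fun φ => by
      rw [Idem.val_inf, map_mul, hL.map_inf hS]
      rcases IsSpeckerAlgebra.map_idem_eq_zero_or_one φ b with h | h <;>
        rcases IsSpeckerAlgebra.map_idem_eq_zero_or_one φ c with h' | h' <;> simp [h, h']
    change P _ _
    rw [this]
    exact hP.p4 _ _ _ h h'
  · intro a b h
    change P _ _
    rw [Idem.val_compl, Idem.val_compl, sub_eq_add_neg, sub_eq_add_neg]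
    exact hP.p6 _ _ _ _ hP.p1_one (hP.p5 _ _ h)
  · intro a b h
    obtain ⟨v, h1, h2⟩ := hP.p9 _ _ h
    have h1 := hP.level hS hL h1 1
    have h2 := hP.level hS hL h2 1
    rw [hS.level_idem _ one_pos le_rfl] at h1 h2
    exact ⟨_, h1, h2⟩
  · intro a ha
    have hpos : 0 < a.val := lt_of_le_of_ne (hL.idem_nonneg a) fun h => ha (Idem.ext h.symm)
    obtain ⟨v, hv, hva⟩ := hP.p10 _ hpos
    obtain ⟨φ, hφ⟩ : ∃ φ : S →ₐ[A] A, φ v ≠ 0 := by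
      by_contra! h
      exact hv.ne' (hS.ext_algHom fun φ => by rw [h φ, map_zero])
    have hφv : 0 < φ v := lt_of_le_of_ne (by simpa using (hL.le_iff hS).1 hv.le φ) hφ.symm
    -- Since `φ v > 0`, `[a ≥ φ v]` lies below `a`; and `[v ≥ φ v]` is nonzero because `φ` sends it
    -- to `1`.
    refine ⟨hS.level v (φ v), fun h => ?_, ?_⟩
    · have := (hS.map_level_eq_one (s := v) (φ := φ)).2 le_rfl
      rw [h, Idem.val_bot, map_zero] at this
      exact zero_ne_one this
    · refine hP.p3 _ _ _ _ le_rfl (hP.level hS hL hva (φ v)) (hle.1 ?_)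
      refine hS.idem_le_iff.2 fun ψ hψ => ?_
      rw [hS.map_level_eq_one] at hψ
      refine (IsSpeckerAlgebra.map_idem_eq_zero_or_one ψ a).resolve_left fun h => ?_
      exact (h ▸ hφv.trans_le hψ).false

end IsAlgebraProximity

theorem mainTheorem9 {A S : Type*} [CommRing A] [LinearOrder A] [IsStrictOrderedRing A]
    [CommRing S] [Algebra A S] (hS : IsSpeckerAlgebra A S) :
    (∃! L : Lattice S, @IsTorsionFreeFAlgebra A S _ _ _ _ L) ∧
    ∀ L : Lattice S, IsTorsionFreeFAlgebra A S →
      (∀ R : Idem S → Idem S → Prop, IsBooleanProximity R →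
        ∃! P : S → S → Prop, IsAlgebraProximity A P ∧ restrictToIdem P = R) ∧
      (∀ P Q : S → S → Prop, IsAlgebraProximity A P → IsAlgebraProximity A Q →
        restrictToIdem P = restrictToIdem Q → P = Q) ∧
      Set.BijOn restrictToIdem {P : S → S → Prop | IsAlgebraProximity A P}
        {R : Idem S → Idem S → Prop | IsBooleanProximity R} := by
  refine ⟨hS.existsUnique_lattice, fun _ hL => ?_⟩
  have inj : ∀ P Q : S → S → Prop, IsAlgebraProximity A P → IsAlgebraProximity A Q →
      restrictToIdem P = restrictToIdem Q → P = Q := fun P Q hP hQ h => by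
    rw [hP.eq_extend hS hL, hQ.eq_extend hS hL, h]
  refine ⟨fun R hR => ⟨hS.extend R, ⟨hS.isAlgebraProximity_extend hL hR,
    hS.restrictToIdem_extend hR⟩, fun P hP => ?_⟩, inj, ?_, ?_, ?_⟩
  · exact inj _ _ hP.1 (hS.isAlgebraProximity_extend hL hR)
      (hP.2.trans (hS.restrictToIdem_extend hR).symm)
  · exact fun P hP => IsAlgebraProximity.isBooleanProximity_restrictToIdem hP hS hL
  · exact fun P hP Q hQ h => inj P Q hP hQ h
  · exact fun R hR => ⟨hS.extend R, hS.isAlgebraProximity_extend hL hR,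
      hS.restrictToIdem_extend hR⟩
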